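/- Let $\alpha\in(2,\infty)\setminus\mathbb Z$, let $l$ be slowly varying, i.e. $\lim_{x\to\infty} l(\lambda x)/l(x)=1$ for every $\lambda>0$, and let $H$ be a nonnegative random variable with $\mathbb P(H>h)=h^{1-\alpha}l(h)$ for all $h\ge1$; put $\mu=\mathbb E(H)$. In the Chung--Lu random graph on $n$ nodes, the nodes receive i.i.d. weights $H_1,\dots,H_n$ distributed as $H$ and, given the weights, each pair of distinct nodes $i,j$ is joined by an edge, independently of all other pairs, with probability $\min\{H_iH_j/(\mu n),1\}$. Fix an integer $k\ge2$. Let $A_k(n)$ be the expected number of cliques with $k$ nodes in this graph and $\mathbb P(K_k)$ the probability (for $n\ge k$) that the nodes $1,\dots,k$ form a clique. Then $A_k(n)=\binom nk\mathbb P(K_k)$ for all $n\ge k$, and $$A_k(n)\asymp\begin{cases} n^{\frac k2(3-k)} & \text{when } k<\alpha,\\ n^{\frac k2(3-\alpha)}\,l(\sqrt n)^k & \text{when } k>\alpha.\end{cases}$$ Here $f(n)\asymp g(n)$ means that there are constants $n_0\ge0$ and $0<C_1<C_2<\infty$ such that $C_1g(n)\le f(n)\le C_2g(n)$ for all integers $n>n_0$.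 -/

import Mathlib

open MeasureTheory ProbabilityTheory Filter Topology

/-- Slow variation in the sense of Karamata: `l (c x) / l x → 1` as `x → ∞`, for all `c > 0`. -/
def IsSlowlyVarying (l : ℝ → ℝ) : Prop :=
  ∀ c : ℝ, 0 < c → Tendsto (fun x => l (c * x) / l x) atTop (𝓝 1)

/-- `f ≍ g`: there are constants `n₀` and `0 < C₁ < C₂ < ∞` such that
`C₁ g n ≤ f n ≤ C₂ g n` for all `n > n₀`. -/
def SameOrder (f g : ℕ → ℝ) : Prop :=
  ∃ (n₀ : ℕ) (C₁ C₂ : ℝ), 0 < C₁ ∧ C₁ < C₂ ∧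
    ∀ n : ℕ, n₀ < n → C₁ * g n ≤ f n ∧ f n ≤ C₂ * g n

namespace ChungLu

/-- The unordered pairs of distinct nodes, each listed once with the smaller node first. -/
abbrev NodePair (n : ℕ) : Type := {p : Fin n × Fin n // p.1 < p.2}

/-- The edge probability `p_{i,j} = min {h_i h_j / (μ n), 1}`. -/
noncomputable def edgeProb (μ : ℝ) {n : ℕ} (h : Fin n → ℝ) (i j : Fin n) : ℝ :=
  min (h i * h j / (μ * n)) 1

/-- Given the weights `h`, the edge indicators of the pairs of nodes are independent Bernoulli
variables, the one of `{i, j}` with parameter `edgeProb μ h i j`. (The projection to `[0, 1]` does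
nothing when `μ` and the weights are nonnegative.) -/
noncomputable def edgeLaw (μ : ℝ) {n : ℕ} (h : Fin n → ℝ) : Measure (NodePair n → Bool) :=
  Measure.pi fun e =>
    bernoulliMeasure true false (Set.projIcc 0 1 zero_le_one (edgeProb μ h e.1.1 e.1.2))

instance (μ : ℝ) {n : ℕ} (h : Fin n → ℝ) : IsProbabilityMeasure (edgeLaw μ h) := by
  unfold edgeLaw; infer_instance

theorem measurable_edgeLaw (μ : ℝ) (n : ℕ) :
    Measurable (edgeLaw μ : (Fin n → ℝ) → Measure (NodePair n → Bool)) := by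
  classical
  refine Measure.measurable_of_measurable_coe _ fun s _ => ?_
  have key : ∀ h : Fin n → ℝ, edgeLaw μ h s = ∑ ω ∈ s.toFinset, edgeLaw μ h {ω} := by
    intro h
    rw [sum_measure_singleton, Set.coe_toFinset]
  simp only [key]
  refine Finset.measurable_sum _ fun ω _ => ?_
  have hsing : ∀ h : Fin n → ℝ, edgeLaw μ h {ω} = ∏ e : NodePair n,
      bernoulliMeasure true false
        (Set.projIcc 0 1 zero_le_one (edgeProb μ h e.1.1 e.1.2)) {ω e} := by
    intro h
    rw [edgeLaw, ← Set.univ_pi_singleton, Measure.pi_pi]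
  simp only [hsing]
  refine Finset.measurable_prod _ fun e _ => ?_
  have hp : Measurable fun h : Fin n → ℝ =>
      (Set.projIcc (0 : ℝ) 1 zero_le_one (edgeProb μ h e.1.1 e.1.2) : unitInterval) := by
    refine continuous_projIcc.measurable.comp ?_
    unfold edgeProb
    fun_prop
  have hp' := unitInterval.continuous_symm.measurable.comp hp
  have hr : ∀ q : unitInterval, (unitInterval.toNNReal q : ENNReal) = ENNReal.ofReal q := by
    intro q
    rw [← unitInterval.coe_toNNReal, ENNReal.ofReal_coe_nnreal]
  simp only [bernoulliMeasure_def, Measure.add_apply, Measure.smul_apply, ENNReal.smul_def, hr]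
  exact ((hp.subtype_val.ennreal_ofReal).smul_const _).add
    ((hp'.subtype_val.ennreal_ofReal).smul_const _)

/-- The conditional law of the edge indicators given the weights, as a Markov kernel. -/
noncomputable def edgeKernel (μ : ℝ) (n : ℕ) : Kernel (Fin n → ℝ) (NodePair n → Bool) :=
  ⟨edgeLaw μ, measurable_edgeLaw μ n⟩

instance (μ : ℝ) (n : ℕ) : IsMarkovKernel (edgeKernel μ n) :=
  ⟨fun h => inferInstanceAs (IsProbabilityMeasure (edgeLaw μ h))⟩

/-- The Chung--Lu model with `n` nodes and weight distribution `ν`, as the joint law of the weights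
`(H_1, …, H_n)`, which are i.i.d. with law `ν`, and of the edge indicators, which have the law
`edgeLaw` given the weights, where `μ` is the mean of `ν`. -/
noncomputable def model (ν : Measure ℝ) (n : ℕ) :
    Measure ((Fin n → ℝ) × (NodePair n → Bool)) :=
  (Measure.pi fun _ : Fin n => ν) ⊗ₘ edgeKernel (∫ h, h ∂ν) n

instance (ν : Measure ℝ) [IsProbabilityMeasure ν] (n : ℕ) : IsProbabilityMeasure (model ν n) := by
  unfold model; infer_instance

/-- The random graph on the nodes `Fin n`, as a function of the outcome. -/
def graph {n : ℕ} (x : (Fin n → ℝ) × (NodePair n → Bool)) : SimpleGraph (Fin n) where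
  Adj i j := (∃ hij : i < j, x.2 ⟨(i, j), hij⟩ = true) ∨ (∃ hji : j < i, x.2 ⟨(j, i), hji⟩ = true)
  symm := ⟨fun _ _ h => h.symm⟩
  loopless := ⟨fun i h => by
    rcases h with ⟨h, _⟩ | ⟨h, _⟩ <;> exact lt_irrefl i h⟩

/-- `A_k(n)`: the expected number of cliques with `k` nodes in the random graph. -/
noncomputable def expectedCliques (ν : Measure ℝ) (k n : ℕ) : ℝ :=
  ∫ x, (((graph x).cliqueSet k).ncard : ℝ) ∂(model ν n)

/-- `ℙ(K_k)`: the probability that the first `k` of the `n` nodes form a clique (used for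
`k ≤ n`). -/
noncomputable def cliqueProb (ν : Measure ℝ) (k n : ℕ) : ℝ :=
  (model ν n).real {x | (graph x).IsClique {i : Fin n | (i : ℕ) < k}}

end ChungLu

/-! All `k`-sets of nodes are cliques with the same probability, so everything reduces to Q = E
∏_{i<j} min(X_i X_j, 1), where X_i = H_i / a and a = √(μ n). Write T for the tail of H and β = α - 1
for its index. If k - 1 < β, the moment of order k - 1 is finite. Dropping the minimum bounds Q by
(E X^(k-1))^k, and on the event that all H_i ≤ a the minimum is inactive, so Q has order
a^(-k(k-1)): cliques come from nodes of bounded weight. If k - 1 > β, cliques come from nodes of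
weight about √n. The event that all H_i > a gives Q ≥ T(a)^k. For the matching upper bound the
product over pairs is dominated by a product ∏ g(X_i), with g(x) = x^p for x ≤ 1 and x^q for x > 1,
where q < β < p (`exists_prod_min_le`). Karamata-type estimates then give E g(H / a) = O(T(a)), and
regular variation replaces T(a) by T(√n). Multiplying by the binomial coefficient, of order n^k,
gives both rates. -/

namespace ChungLu

/-! ### Products over pairs of nodes -/

/-- A product over ordered pairs as an iterated product. -/
theorem prod_nodePair {M : Type*} [CommMonoid M] {n : ℕ} (F : Fin n → Fin n → M) :
    ∏ e : NodePair n, F e.1.1 e.1.2 = ∏ i, ∏ j, if i < j then F i j else 1 := by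
  rw [← Fintype.prod_prod_type' (f := fun i j => if i < j then F i j else 1),
    ← Finset.prod_filter]
  exact (Finset.prod_subtype (p := fun p : Fin n × Fin n => p.1 < p.2) _ (by simp)
    (fun p => F p.1 p.2)).symm

/-- Regroups a product over edges by endpoint; this is what lets an edge-wise bound become a product
of functions of single weights. -/
theorem prod_nodePair_mul_swap {M : Type*} [CommMonoid M] {n : ℕ} (F : Fin n → Fin n → M) :
    ∏ e : NodePair n, (F e.1.1 e.1.2 * F e.1.2 e.1.1) =
      ∏ i, ∏ j ∈ Finset.univ.erase i, F i j := by
  rw [Finset.prod_mul_distrib, prod_nodePair, prod_nodePair (fun i j => F j i)]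
  rw [Finset.prod_comm (f := fun i j => if i < j then F j i else 1), ← Finset.prod_mul_distrib]
  refine Finset.prod_congr rfl fun i _ => ?_
  rw [← Finset.prod_mul_distrib, ← Finset.filter_ne' Finset.univ i, Finset.prod_filter]
  refine Finset.prod_congr rfl fun j _ => ?_
  rcases lt_trichotomy i j with h | h | h
  · simp [h, h.not_gt, h.ne']
  · simp [h]
  · simp [h, h.not_gt, h.ne]

/-- Monotonicity of `ι` matters because `NodePair` lists each pair with the smaller node first. -/
theorem prod_nodePair_of_strictMono {M : Type*} [CommMonoid M] {k n : ℕ} (ι : Fin k ↪ Fin n)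
    (hι : StrictMono ι) (F : Fin n → Fin n → M) :
    (∏ e : NodePair n, if e.1.1 ∈ Set.range ι ∧ e.1.2 ∈ Set.range ι then F e.1.1 e.1.2 else 1) =
      ∏ e : NodePair k, F (ι e.1.1) (ι e.1.2) := by
  classical
  rw [prod_nodePair (fun i j => F (ι i) (ι j)), prod_nodePair
    (fun i j => if i ∈ Set.range ι ∧ j ∈ Set.range ι then F i j else 1)]
  have key : ∀ G : Fin n → M, (∀ i, i ∉ Set.range ι → G i = 1) → ∏ i, G i = ∏ i, G (ι i) := by
    intro G hG
    rw [← Finset.prod_map Finset.univ ι G]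
    refine (Finset.prod_subset (Finset.subset_univ _) fun i _ hi => hG i ?_).symm
    simpa using hi
  rw [key]
  · refine Finset.prod_congr rfl fun i _ => ?_
    rw [key]
    · refine Finset.prod_congr rfl fun j _ => ?_
      simp [hι.lt_iff_lt]
    · intro j hj
      simp [hj]
  · intro i hi
    simp [hi]

/-! ### Product measures and the probability of a clique -/

theorem lintegral_pi_prod {ι : Type*} [Fintype ι] (ν : Measure ℝ) [IsProbabilityMeasure ν]
    (f : ι → ℝ → ENNReal) (hf : ∀ i, Measurable (f i)) :
    ∫⁻ x, ∏ i, f i (x i) ∂(Measure.pi fun _ : ι => ν) = ∏ i, ∫⁻ x, f i x ∂ν := by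
  have h := iIndepFun_pi (μ := fun _ : ι => ν) (X := f) (fun i => (hf i).aemeasurable)
  rw [lintegral_prod_eq_prod_lintegral_of_indepFun Finset.univ _ h
    (fun i => (hf i).comp (measurable_pi_apply i))]
  refine Finset.prod_congr rfl fun i _ => ?_
  exact (measurePreserving_eval (fun _ : ι => ν) i).lintegral_comp (hf i)

theorem map_pi_comp_injective {ι κ : Type*} [Fintype ι] [Fintype κ] (ν : Measure ℝ)
    [IsProbabilityMeasure ν] (g : κ → ι) (hg : g.Injective) :
    (Measure.pi fun _ : ι => ν).map (fun x i => x (g i)) = Measure.pi fun _ : κ => ν := by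
  have h := iIndepFun_pi (μ := fun _ : ι => ν) (X := fun _ => id) (fun i => aemeasurable_id)
  have h' := h.precomp hg
  rw [iIndepFun_iff_map_fun_eq_pi_map] at h'
  · refine Eq.trans h' ?_
    congr 1
    ext1 i
    exact (measurePreserving_eval (fun _ : ι => ν) (g i)).map_eq
  · exact fun i => (measurable_pi_apply (g i)).aemeasurable

/-- The probability that `k` nodes with i.i.d. weights of law `ν` form a clique when each pair is
joined with probability `min {h_i h_j / c, 1}`. -/
noncomputable def cliqueMass (ν : Measure ℝ) (k : ℕ) (c : ℝ) : ENNReal :=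
  ∫⁻ h : Fin k → ℝ, ∏ e : NodePair k, ENNReal.ofReal (min (h e.1.1 * h e.1.2 / c) 1)
    ∂(Measure.pi fun _ => ν)

theorem cliqueMass_le_one (ν : Measure ℝ) [IsProbabilityMeasure ν] (k : ℕ) (c : ℝ) :
    cliqueMass ν k c ≤ 1 := by
  calc cliqueMass ν k c ≤ ∫⁻ _ : Fin k → ℝ, 1 ∂(Measure.pi fun _ => ν) := by
        refine lintegral_mono fun h => Finset.prod_le_one' fun e _ => ?_
        simp
    _ = 1 := by simp

theorem edgeLaw_forall_true (μ : ℝ) {n : ℕ} (h : Fin n → ℝ) (P : NodePair n → Prop)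
    [DecidablePred P] :
    edgeLaw μ h {ω | ∀ e, P e → ω e = true} =
      ∏ e : NodePair n, if P e then ENNReal.ofReal (edgeProb μ h e.1.1 e.1.2) else 1 := by
  have hs : {ω : NodePair n → Bool | ∀ e, P e → ω e = true} =
      Set.univ.pi fun e => if P e then {true} else Set.univ := by
    ext ω
    simp only [Set.mem_ofPred_eq, Set.mem_univ_pi]
    refine forall_congr' fun e => ?_
    split_ifs with he <;> simp [he]
  rw [hs, edgeLaw, Measure.pi_pi]
  refine Finset.prod_congr rfl fun e _ => ?_
  split_ifs with he
  · rw [bernoulliMeasure_apply_of_mem_of_notMem _ (measurableSet_singleton _) (by simp) (by simp)]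
    set q := Set.projIcc (0 : ℝ) 1 zero_le_one (edgeProb μ h e.1.1 e.1.2) with hq
    -- The projection to [0, 1] disappears: the upper cut is already in `edgeProb`, and the lower
    -- cut is made by `ENNReal.ofReal`. Hence no sign condition on the weights.
    have h1 : ((unitInterval.toNNReal q : NNReal) : ENNReal) = ENNReal.ofReal q := by
      rw [← unitInterval.coe_toNNReal, ENNReal.ofReal_coe_nnreal]
    rw [h1, hq, Set.coe_projIcc]
    have h2 : edgeProb μ h e.1.1 e.1.2 ≤ 1 := min_le_right _ _
    rw [min_eq_right h2, ENNReal.ofReal_max]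
    simp
  · simp

theorem isClique_graph_iff {n : ℕ} (x : (Fin n → ℝ) × (NodePair n → Bool)) (s : Set (Fin n)) :
    (graph x).IsClique s ↔ ∀ e : NodePair n, e.1.1 ∈ s ∧ e.1.2 ∈ s → x.2 e = true := by
  constructor
  · rintro h ⟨⟨i, j⟩, hij⟩ ⟨hi, hj⟩
    rcases h hi hj (ne_of_lt hij) with ⟨_, h'⟩ | ⟨h', _⟩
    · exact h'
    · exact absurd h' (lt_asymm hij)
  · intro h i hi j hj hij
    rcases lt_or_gt_of_ne hij with h' | h'
    · exact Or.inl ⟨h', h ⟨(i, j), h'⟩ ⟨hi, hj⟩⟩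
    · exact Or.inr ⟨h', h ⟨(j, i), h'⟩ ⟨hj, hi⟩⟩

theorem measurableSet_isClique {n : ℕ} (s : Set (Fin n)) :
    MeasurableSet {x : (Fin n → ℝ) × (NodePair n → Bool) | (graph x).IsClique s} := by
  simp only [isClique_graph_iff]
  exact measurable_snd (MeasurableSet.of_discrete
    (s := {ω : NodePair n → Bool | ∀ e : NodePair n, e.1.1 ∈ s ∧ e.1.2 ∈ s → ω e = true}))

/-- Integrating out the edges leaves only factors of pairs inside the range of `ι`, and the weights
there are again i.i.d. with law `ν`; so the probability does not depend on which `k` nodes are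
chosen. -/
theorem model_isClique (ν : Measure ℝ) [IsProbabilityMeasure ν] {k n : ℕ} (ι : Fin k ↪o Fin n) :
    model ν n {x | (graph x).IsClique (Set.range ι)} = cliqueMass ν k ((∫ h, h ∂ν) * n) := by
  classical
  set μ := ∫ h, h ∂ν
  have h1 : model ν n {x | (graph x).IsClique (Set.range ι)} =
      ∫⁻ h, edgeLaw μ h {ω | ∀ e : NodePair n, e.1.1 ∈ Set.range ι ∧ e.1.2 ∈ Set.range ι →
        ω e = true} ∂(Measure.pi fun _ : Fin n => ν) := by
    rw [model, Measure.compProd_apply (measurableSet_isClique _)]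
    refine lintegral_congr fun h => ?_
    simp only [isClique_graph_iff]
    rfl
  rw [h1]
  simp only [edgeLaw_forall_true]
  rw [cliqueMass, ← map_pi_comp_injective ν ι ι.injective, lintegral_map]
  · refine lintegral_congr fun h => ?_
    exact prod_nodePair_of_strictMono ι.toEmbedding ι.strictMono
      (fun i j => ENNReal.ofReal (edgeProb μ h i j))
  · fun_prop
  · fun_prop

theorem cliqueProb_eq (ν : Measure ℝ) [IsProbabilityMeasure ν] {k n : ℕ} (hkn : k ≤ n) :
    cliqueProb ν k n = (cliqueMass ν k ((∫ h, h ∂ν) * n)).toReal := by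
  rw [← model_isClique ν (Fin.castLEOrderEmb hkn), cliqueProb, Measure.real]
  congr 4
  ext x
  have : {i : Fin n | (i : ℕ) < k} = Set.range (Fin.castLEOrderEmb hkn) := by
    ext i
    simp only [Set.mem_ofPred_eq, Set.mem_range]
    exact ⟨fun h => ⟨⟨i, h⟩, by ext; simp⟩, by rintro ⟨j, rfl⟩; simp⟩
  simp [this]

theorem expectedCliques_eq (ν : Measure ℝ) [IsProbabilityMeasure ν] (k n : ℕ) :
    expectedCliques ν k n =
      (n.choose k : ℝ) * (cliqueMass ν k ((∫ h, h ∂ν) * n)).toReal := by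
  classical
  have h1 : ∀ x : (Fin n → ℝ) × (NodePair n → Bool),
      (((graph x).cliqueSet k).ncard : ℝ) =
        ∑ s ∈ Finset.powersetCard k (Finset.univ : Finset (Fin n)),
        {x : (Fin n → ℝ) × (NodePair n → Bool) | (graph x).IsClique (s : Set (Fin n))}.indicator
          1 x := by
    intro x
    have : (graph x).cliqueSet k = ↑((Finset.powersetCard k (Finset.univ : Finset (Fin n))).filter
        fun s : Finset (Fin n) => (graph x).IsClique (s : Set (Fin n)) :
          Finset (Finset (Fin n))) := by
      ext s
      simp [SimpleGraph.mem_cliqueSet_iff, SimpleGraph.isNClique_iff, and_comm]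
    rw [this, Set.ncard_coe_finset, Finset.card_filter]
    push_cast
    refine Finset.sum_congr rfl fun s _ => ?_
    simp [Set.indicator_apply]
  have h2 : ∀ s ∈ Finset.powersetCard k (Finset.univ : Finset (Fin n)),
      (model ν n).real {x | (graph x).IsClique (s : Set (Fin n))} =
        (cliqueMass ν k ((∫ h, h ∂ν) * n)).toReal := by
    intro s hs
    rw [Finset.mem_powersetCard] at hs
    rw [← model_isClique ν (s.orderEmbOfFin hs.2), Measure.real, Finset.range_orderEmbOfFin]
  rw [expectedCliques]
  simp only [h1]
  rw [integral_finsetSum]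
  · simp only [integral_indicator_one (measurableSet_isClique _)]
    rw [Finset.sum_congr rfl h2]
    simp
  · intro s _
    exact (integrable_const (1 : ℝ)).indicator (measurableSet_isClique _)

/-! ### Karamata-type moment estimates -/

theorem setLIntegral_rpow_le (ν : Measure ℝ) [IsFiniteMeasure ν] {s : Set ℝ}
    (hs : MeasurableSet s) {b p : ℝ} (hp : 0 ≤ p) (hb : 0 ≤ b) (h : ∀ x ∈ s, 0 ≤ x ∧ x ≤ b) :
    ∫⁻ x in s, ENNReal.ofReal (x ^ p) ∂ν ≤ ENNReal.ofReal (b ^ p * ν.real s) := by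
  rw [ENNReal.ofReal_mul (Real.rpow_nonneg hb p), ofReal_measureReal, ← setLIntegral_const]
  exact setLIntegral_mono' hs fun x hx =>
    ENNReal.ofReal_le_ofReal (Real.rpow_le_rpow (h x hx).1 (h x hx).2 hp)

/-- Truncated moments of an order above the tail index. -/
theorem exists_setLIntegral_Icc_le (ν : Measure ℝ) [IsProbabilityMeasure ν] {β p : ℝ}
    (hT0 : ∀ x, 0 < ν.real (Set.Ioi x))
    (hT : Tendsto (fun x => ν.real (Set.Ioi (2 * x)) / ν.real (Set.Ioi x)) atTop
      (𝓝 (2 ^ (-β)))) (hp0 : 0 ≤ p) (hp : β < p) :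
    ∃ C x₀ : ℝ, 0 < C ∧ 1 ≤ x₀ ∧ ∀ a, x₀ ≤ a →
      ∫⁻ x in Set.Icc 0 a, ENNReal.ofReal (x ^ p) ∂ν ≤
        ENNReal.ofReal (C * (a ^ p * ν.real (Set.Ioi a))) := by
  set T : ℝ → ℝ := fun x => ν.real (Set.Ioi x) with hTdef
  have h2p : (0 : ℝ) < 2 ^ p := by positivity
  -- Since p > β, x^p T(x) eventually grows by a factor above 1 at each doubling, so the dyadic
  -- blocks below `a` are dominated by the last one.
  obtain ⟨r, hr0, hr1, x₀, hx₀, hr⟩ : ∃ r : ℝ, 0 < r ∧ r < 1 ∧ ∃ x₀ : ℝ, 1 ≤ x₀ ∧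
      ∀ x, x₀ ≤ x → T x ≤ r * (2 ^ p * T (2 * x)) := by
    have hlim : Tendsto (fun x => 2 ^ p * (T (2 * x) / T x)) atTop (𝓝 (2 ^ p * 2 ^ (-β))) :=
      hT.const_mul _
    have hgt : (1 : ℝ) < 2 ^ p * 2 ^ (-β) := by
      rw [← Real.rpow_add two_pos]
      exact Real.one_lt_rpow one_lt_two (by linarith)
    obtain ⟨R, hR1, hR2⟩ := exists_between hgt
    obtain ⟨x₁, hx₁⟩ := eventually_atTop.1 (hlim.eventually_const_le hR2)
    refine ⟨R⁻¹, by positivity, inv_lt_one_of_one_lt₀ hR1, max 1 x₁, le_max_left _ _,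
      fun x hx => ?_⟩
    have := hx₁ x ((le_max_right _ _).trans hx)
    rw [← mul_div_assoc, le_div_iff₀ (hT0 x)] at this
    rwa [inv_mul_eq_div, le_div_iff₀' (by linarith)]
  -- The first entry covers the starting range [x₀, 2x₀]; the second makes (C + 2^p) r ≤ C, which
  -- closes the induction on doublings.
  set C := max (1 / T (2 * x₀)) (2 ^ p * r / (1 - r)) with hC
  have hCpos : 0 < C := lt_max_of_lt_left (one_div_pos.2 (hT0 _))
  have hCr : (C + 2 ^ p) * r ≤ C := by
    have : 2 ^ p * r / (1 - r) ≤ C := le_max_right _ _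
    rw [div_le_iff₀ (by linarith)] at this
    linarith
  have base : ∀ a, x₀ ≤ a → a ≤ 2 * x₀ →
      ∫⁻ x in Set.Icc 0 a, ENNReal.ofReal (x ^ p) ∂ν ≤ ENNReal.ofReal (C * (a ^ p * T a)) := by
    intro a ha ha'
    have ha0 : 0 ≤ a := by linarith
    refine (setLIntegral_rpow_le ν measurableSet_Icc hp0 ha0 fun x hx => hx).trans
      (ENNReal.ofReal_le_ofReal ?_)
    have h1 : T (2 * x₀) ≤ T a := measureReal_mono (Set.Ioi_subset_Ioi ha')
    have h2 : 1 ≤ C * T a := by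
      have h3 : 1 / T (2 * x₀) ≤ C := le_max_left _ _
      rw [div_le_iff₀ (hT0 _)] at h3
      exact h3.trans (by gcongr)
    calc a ^ p * ν.real (Set.Icc 0 a) ≤ a ^ p * 1 := by
          gcongr; exact measureReal_le_one
      _ ≤ a ^ p * (C * T a) := by gcongr
      _ = _ := by ring
  have step : ∀ N : ℕ, ∀ a, x₀ ≤ a → a ≤ 2 ^ N * (2 * x₀) →
      ∫⁻ x in Set.Icc 0 a, ENNReal.ofReal (x ^ p) ∂ν ≤ ENNReal.ofReal (C * (a ^ p * T a)) := by
    intro N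
    induction N with
    | zero => intro a ha ha'; exact base a ha (by simpa using ha')
    | succ N ih =>
      intro a ha ha'
      rcases le_total a (2 * x₀) with h | h
      · exact base a ha h
      obtain ⟨b, rfl⟩ : ∃ b, a = 2 * b := ⟨a / 2, by ring⟩
      have hb : x₀ ≤ b := by linarith
      have hb0 : 0 ≤ b := by linarith
      have hb' : b ≤ 2 ^ N * (2 * x₀) := by rw [pow_succ] at ha'; linarith
      have hun : Set.Icc 0 (2 * b) = Set.Icc 0 b ∪ Set.Ioc b (2 * b) :=
        (Set.Icc_union_Ioc_eq_Icc hb0 (by linarith)).symm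
      rw [hun]
      refine (lintegral_union_le _ _ _).trans ?_
      have h1 : ∫⁻ x in Set.Ioc b (2 * b), ENNReal.ofReal (x ^ p) ∂ν ≤
          ENNReal.ofReal ((2 * b) ^ p * T b) := by
        refine (setLIntegral_rpow_le ν measurableSet_Ioc hp0 (b := 2 * b) (by linarith)
          fun x hx => ⟨by linarith [hx.1], hx.2⟩).trans (ENNReal.ofReal_le_ofReal ?_)
        exact mul_le_mul_of_nonneg_left (measureReal_mono Set.Ioc_subset_Ioi_self)
          (Real.rpow_nonneg (by linarith) _)
      refine (add_le_add (ih b hb hb') h1).trans ?_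
      have hTb := (hT0 b).le
      rw [← ENNReal.ofReal_add (by positivity) (by positivity)]
      refine ENNReal.ofReal_le_ofReal ?_
      rw [Real.mul_rpow zero_le_two hb0]
      have h3 := hr b hb
      have hbp : 0 ≤ b ^ p := by positivity
      have hT2 : 0 ≤ T (2 * b) := (hT0 _).le
      calc C * (b ^ p * T b) + 2 ^ p * b ^ p * T b = (C + 2 ^ p) * b ^ p * T b := by ring
        _ ≤ (C + 2 ^ p) * b ^ p * (r * (2 ^ p * T (2 * b))) := by gcongr
        _ = ((C + 2 ^ p) * r) * (2 ^ p * b ^ p * T (2 * b)) := by ring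
        _ ≤ C * (2 ^ p * b ^ p * T (2 * b)) := by gcongr
  refine ⟨C, x₀, hCpos, hx₀, fun a ha => ?_⟩
  obtain ⟨N, hN⟩ := pow_unbounded_of_one_lt a one_lt_two
  refine step N a ha (hN.le.trans ?_)
  nlinarith [pow_pos (two_pos : (0 : ℝ) < 2) N]

/-- Tail moments of an order below the tail index. -/
theorem exists_setLIntegral_Ioi_le (ν : Measure ℝ) [IsProbabilityMeasure ν] {β q : ℝ}
    (hT0 : ∀ x, 0 < ν.real (Set.Ioi x))
    (hT : Tendsto (fun x => ν.real (Set.Ioi (2 * x)) / ν.real (Set.Ioi x)) atTop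
      (𝓝 (2 ^ (-β)))) (hq0 : 0 ≤ q) (hq : q < β) :
    ∃ C x₀ : ℝ, 0 < C ∧ 1 ≤ x₀ ∧ ∀ a, x₀ ≤ a →
      ∫⁻ x in Set.Ioi a, ENNReal.ofReal (x ^ q) ∂ν ≤
        ENNReal.ofReal (C * (a ^ q * ν.real (Set.Ioi a))) := by
  set T : ℝ → ℝ := fun x => ν.real (Set.Ioi x) with hTdef
  -- Since q < β, x^q T(x) now decays geometrically under doubling, and the first dyadic block above
  -- `a` dominates.
  obtain ⟨r, hr1, x₀, hx₀, hr⟩ : ∃ r : ℝ, r < 1 ∧ ∃ x₀ : ℝ, 1 ≤ x₀ ∧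
      ∀ x, x₀ ≤ x → 2 ^ q * T (2 * x) ≤ r * T x := by
    have hlim : Tendsto (fun x => 2 ^ q * (T (2 * x) / T x)) atTop (𝓝 (2 ^ q * 2 ^ (-β))) :=
      hT.const_mul _
    have hlt : (2 : ℝ) ^ q * 2 ^ (-β) < 1 := by
      rw [← Real.rpow_add two_pos]
      exact Real.rpow_lt_one_of_one_lt_of_neg one_lt_two (by linarith)
    obtain ⟨r, hr1, hr2⟩ := exists_between hlt
    obtain ⟨x₁, hx₁⟩ := eventually_atTop.1 (hlim.eventually_le_const hr1)
    refine ⟨r, hr2, max 1 x₁, le_max_left _ _, fun x hx => ?_⟩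
    have := hx₁ x ((le_max_right _ _).trans hx)
    rwa [← mul_div_assoc, div_le_iff₀ (hT0 x)] at this
  -- The fixed point of C = 2^q + C r, the sum of the geometric series. The bound is thus uniform in
  -- the truncation level 2^N a, which then tends to infinity.
  set C := 2 ^ q / (1 - r) with hC
  have h1r : 0 < 1 - r := by linarith
  have hCpos : 0 < C := by positivity
  have hCr : 2 ^ q + C * r = C := by
    rw [hC]; field_simp; ring
  have step : ∀ N : ℕ, ∀ a, x₀ ≤ a →
      ∫⁻ x in Set.Ioc a (2 ^ N * a), ENNReal.ofReal (x ^ q) ∂ν ≤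
        ENNReal.ofReal (C * (a ^ q * T a)) := by
    intro N
    induction N with
    | zero => intro a _; simp
    | succ N ih =>
      intro a ha
      have ha0 : 0 ≤ a := by linarith
      have hsub : Set.Ioc a (2 ^ (N + 1) * a) ⊆ Set.Ioc a (2 * a) ∪
          Set.Ioc (2 * a) (2 ^ N * (2 * a)) := by
        intro x hx
        rcases le_or_gt x (2 * a) with h | h
        · exact Or.inl ⟨hx.1, h⟩
        · exact Or.inr ⟨h, hx.2.trans_eq (by ring)⟩
      refine (lintegral_mono_set hsub).trans ((lintegral_union_le _ _ _).trans ?_)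
      have h1 : ∫⁻ x in Set.Ioc a (2 * a), ENNReal.ofReal (x ^ q) ∂ν ≤
          ENNReal.ofReal ((2 * a) ^ q * T a) := by
        refine (setLIntegral_rpow_le ν measurableSet_Ioc hq0 (b := 2 * a) (by linarith)
          fun x hx => ⟨by linarith [hx.1], hx.2⟩).trans (ENNReal.ofReal_le_ofReal ?_)
        exact mul_le_mul_of_nonneg_left (measureReal_mono Set.Ioc_subset_Ioi_self)
          (Real.rpow_nonneg (by linarith) _)
      refine (add_le_add h1 (ih (2 * a) (by linarith))).trans ?_
      have hTa := (hT0 a).le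
      have hT2 : 0 ≤ T (2 * a) := (hT0 _).le
      rw [← ENNReal.ofReal_add (by positivity) (by positivity)]
      refine ENNReal.ofReal_le_ofReal ?_
      rw [Real.mul_rpow zero_le_two ha0]
      have h3 := hr a ha
      have haq : 0 ≤ a ^ q := by positivity
      calc 2 ^ q * a ^ q * T a + C * (2 ^ q * a ^ q * T (2 * a))
          = 2 ^ q * a ^ q * T a + C * a ^ q * (2 ^ q * T (2 * a)) := by ring
        _ ≤ 2 ^ q * a ^ q * T a + C * a ^ q * (r * T a) := by gcongr
        _ = (2 ^ q + C * r) * (a ^ q * T a) := by ring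
        _ = C * (a ^ q * T a) := by rw [hCr]
  refine ⟨C, x₀, hCpos, hx₀, fun a ha => ?_⟩
  have ha1 : 1 ≤ a := hx₀.trans ha
  have hmono : Monotone fun N : ℕ => Set.Ioc a (2 ^ N * a) := by
    intro M N hMN
    exact Set.Ioc_subset_Ioc_right (by gcongr; exact one_le_two)
  have hun : Set.Ioi a = ⋃ N : ℕ, Set.Ioc a (2 ^ N * a) := by
    ext x
    simp only [Set.mem_Ioi, Set.mem_iUnion, Set.mem_Ioc]
    refine ⟨fun h => ?_, fun ⟨N, h, _⟩ => h⟩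
    obtain ⟨N, hN⟩ := pow_unbounded_of_one_lt x one_lt_two
    refine ⟨N, h, hN.le.trans ?_⟩
    nlinarith [pow_pos (two_pos : (0 : ℝ) < 2) N]
  rw [hun, setLIntegral_iUnion_of_directed _ hmono.directed_le, ← hun]
  exact iSup_le fun N => step N a ha

theorem lintegral_rpow_lt_top (ν : Measure ℝ) [IsProbabilityMeasure ν] {β q : ℝ}
    (hν : ν (Set.Iio 0) = 0) (hT0 : ∀ x, 0 < ν.real (Set.Ioi x))
    (hT : Tendsto (fun x => ν.real (Set.Ioi (2 * x)) / ν.real (Set.Ioi x)) atTop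
      (𝓝 (2 ^ (-β)))) (hq0 : 0 ≤ q) (hq : q < β) :
    ∫⁻ x, ENNReal.ofReal (x ^ q) ∂ν < ⊤ := by
  obtain ⟨C, x₀, -, hx₀, h⟩ := exists_setLIntegral_Ioi_le ν hT0 hT hq0 hq
  have hun : (Set.univ : Set ℝ) = Set.Iio 0 ∪ (Set.Icc 0 x₀ ∪ Set.Ioi x₀) := by
    rw [Set.Icc_union_Ioi_eq_Ici (by linarith), Set.Iio_union_Ici]
  rw [← setLIntegral_univ, hun]
  refine (lintegral_union_le _ _ _).trans_lt (ENNReal.add_lt_top.2 ⟨?_, ?_⟩)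
  · rw [setLIntegral_measure_zero _ _ hν]
    exact ENNReal.zero_lt_top
  · refine (lintegral_union_le _ _ _).trans_lt (ENNReal.add_lt_top.2 ⟨?_, ?_⟩)
    · exact (setLIntegral_rpow_le ν measurableSet_Icc hq0 (by linarith) fun x hx => hx).trans_lt
        ENNReal.ofReal_lt_top
    · exact (h x₀ le_rfl).trans_lt ENNReal.ofReal_lt_top

/-! ### Domination of the edge product by a product over nodes -/

/-- The exponent with which the pair `{i, j}` contributes to the power of `x i`, when each factor
`min (x i * x j) 1` is replaced by `x i * x j`, `(x i * x j) ^ θ` or `1` according to whether two,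
one or none of `x i`, `x j` are at most `1`. -/
noncomputable def pairExp {k : ℕ} (x : Fin k → ℝ) (θ : ℝ) (i j : Fin k) : ℝ :=
  if x i ≤ 1 then (if x j ≤ 1 then 1 else θ) else (if x j ≤ 1 then θ else 0)

/-- For t ≥ 0 and any θ in [0, 1], min(t, 1) ≤ t^θ; the values 1, θ, 0 are used for the three kinds
of pairs. -/
theorem min_mul_le_pairExp {k : ℕ} {x : Fin k → ℝ} (hx : ∀ i, 0 ≤ x i) {θ : ℝ} (h0 : 0 ≤ θ)
    (h1 : θ ≤ 1) (i j : Fin k) :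
    min (x i * x j) 1 ≤ x i ^ pairExp x θ i j * x j ^ pairExp x θ j i := by
  have key : min (x i * x j) 1 ≤ x i ^ θ * x j ^ θ := by
    rw [← Real.mul_rpow (hx i) (hx j)]
    have ht := mul_nonneg (hx i) (hx j)
    rcases le_total (x i * x j) 1 with h | h
    · rw [min_eq_left h]
      simpa using Real.rpow_le_rpow_of_exponent_ge' ht h h0 h1
    · rw [min_eq_right h]
      exact Real.one_le_rpow h h0
  unfold pairExp
  split_ifs <;> simp [key]

theorem sum_pairExp {k : ℕ} (x : Fin k → ℝ) (θ : ℝ) (i : Fin k) :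
    ∑ j ∈ Finset.univ.erase i, pairExp x θ i j =
      if x i ≤ 1 then ((Finset.univ.filter fun j => x j ≤ 1).card : ℝ) - 1 +
          θ * (Finset.univ.filter fun j => ¬ x j ≤ 1).card
        else θ * (Finset.univ.filter fun j => x j ≤ 1).card := by
  rw [Finset.sum_erase_eq_sub (Finset.mem_univ i)]
  unfold pairExp
  split_ifs with h
  · rw [Finset.sum_ite]
    simp
    ring
  · rw [Finset.sum_ite]
    simp
    ring

theorem prod_min_le_of_exponents {k : ℕ} {x : Fin k → ℝ} (hx : ∀ i, 0 ≤ x i) {θ p q : ℝ}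
    (h0 : 0 ≤ θ) (h1 : θ ≤ 1) (hp0 : 0 ≤ p)
    (hp : ∀ i, x i ≤ 1 → p ≤ ((Finset.univ.filter fun j => x j ≤ 1).card : ℝ) - 1 +
          θ * (Finset.univ.filter fun j => ¬ x j ≤ 1).card)
    (hq : ∀ i, ¬ x i ≤ 1 → θ * (Finset.univ.filter fun j => x j ≤ 1).card ≤ q) :
    ∏ e : NodePair k, min (x e.1.1 * x e.1.2) 1 ≤
      ∏ i, if x i ≤ 1 then x i ^ p else x i ^ q := by
  calc ∏ e : NodePair k, min (x e.1.1 * x e.1.2) 1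
      ≤ ∏ e : NodePair k, (x e.1.1 ^ pairExp x θ e.1.1 e.1.2 *
          x e.1.2 ^ pairExp x θ e.1.2 e.1.1) :=
        Finset.prod_le_prod (fun e _ => le_min (mul_nonneg (hx _) (hx _)) zero_le_one)
          fun e _ => min_mul_le_pairExp hx h0 h1 _ _
    _ = ∏ i, ∏ j ∈ Finset.univ.erase i, x i ^ pairExp x θ i j :=
        prod_nodePair_mul_swap fun i j => x i ^ pairExp x θ i j
    _ ≤ _ := by
        refine Finset.prod_le_prod
          (fun i _ => Finset.prod_nonneg fun j _ => Real.rpow_nonneg (hx i) _) fun i _ => ?_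
        rw [← Real.rpow_sum_of_nonneg (hx i), sum_pairExp]
        · split_ifs with h
          · exact Real.rpow_le_rpow_of_exponent_ge' (hx i) h hp0 (hp i h)
          · exact Real.rpow_le_rpow_of_exponent_le (not_le.1 h).le (hq i h)
        · intro j _
          unfold pairExp
          split_ifs <;> simp [h0]

/-- With s entries at most 1 and m above, a small entry collects the exponent s - 1 + θ m, which
must be at least p, and a large one collects θ s, which must be at most q. The single parameter θ,
chosen according to s, meets both demands. -/
theorem exists_prod_min_le (k : ℕ) {β : ℝ} (hβ : 1 < β) (hk : β < (k : ℝ) - 1) :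
    ∃ p q : ℝ, β < p ∧ 0 ≤ q ∧ q < β ∧ ∀ x : Fin k → ℝ, (∀ i, 0 ≤ x i) →
      ∏ e : NodePair k, min (x e.1.1 * x e.1.2) 1 ≤
        ∏ i, if x i ≤ 1 then x i ^ p else x i ^ q := by
  have hk0 : (0 : ℝ) < k := by linarith
  obtain ⟨ε, hε0, hε1, hε2, hε3⟩ : ∃ ε : ℝ, 0 < ε ∧ ε * k ≤ 1 ∧ ε * k ≤ (k : ℝ) - 1 - β ∧
      ε ≤ β - 1 := by
    refine ⟨min (min (1 / k) (((k : ℝ) - 1 - β) / k)) (β - 1), ?_, ?_, ?_, min_le_right _ _⟩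
    · refine lt_min (lt_min (by positivity) (div_pos (by linarith) hk0)) (by linarith)
    · rw [← le_div_iff₀ hk0]
      exact (min_le_left _ _).trans (min_le_left _ _)
    · rw [← le_div_iff₀ hk0]
      exact (min_le_left _ _).trans (min_le_right _ _)
  have hεk : ε ≤ ε * k := by nlinarith
  refine ⟨β + ε, β - ε, by linarith, by linarith, by linarith, fun x hx => ?_⟩
  set s := (Finset.univ.filter fun j => x j ≤ 1).card with hs
  set m := (Finset.univ.filter fun j => ¬ x j ≤ 1).card with hm
  have hsm : (s : ℝ) + m = k := by
    have := Finset.card_filter_add_card_filter_not (s := Finset.univ) (fun j => x j ≤ 1)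
    rw [Finset.card_univ, Fintype.card_fin] at this
    exact_mod_cast this
  have hm0 : (0 : ℝ) ≤ m := Nat.cast_nonneg _
  have hs0 : (0 : ℝ) ≤ s := Nat.cast_nonneg _
  -- For few small entries θ = 1 works: the exponents are k - 1 and s. Otherwise θ = (β - ε) / s
  -- makes the large exponent exactly q.
  by_cases hsq : (s : ℝ) ≤ β - ε
  · refine prod_min_le_of_exponents hx zero_le_one le_rfl (by linarith) ?_ ?_
    · intro i _
      rw [← hs, ← hm]
      linarith
    · intro i _
      rw [← hs]
      linarith
  · push Not at hsq
    have hs1 : 1 < s := by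
      have : (1 : ℝ) < s := by linarith
      exact_mod_cast this
    have hs2 : (2 : ℝ) ≤ s := by exact_mod_cast hs1
    refine prod_min_le_of_exponents (θ := (β - ε) / s) hx (div_nonneg (by linarith) hs0)
      ((div_le_one (by linarith)).2 hsq.le) (by linarith) ?_ ?_
    · intro i _
      rw [← hs, ← hm, ← sub_le_iff_le_add', div_mul_eq_mul_div, le_div_iff₀ (by linarith)]
      -- This is s - 1 + θ m ≥ β + ε multiplied by s. For s ≤ m, s(s - 1) ≥ 1 suffices, as s > β - ε
      -- ≥ 1; for s > m, the identity in `h2` exhibits the term (k - 1 - β)(s - m).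
      have hmain : ε * k ≤ s * (s - 1) + β * (m - s) := by
        rcases le_or_gt s m with h | h
        · have : (s : ℝ) ≤ m := by exact_mod_cast h
          nlinarith
        · have h' : (m : ℝ) + 1 ≤ s := by exact_mod_cast h
          have hmm : (0 : ℝ) ≤ m * (m - 1) := by
            rcases Nat.eq_zero_or_pos m with h0 | h0
            · simp [h0]
            · have : (1 : ℝ) ≤ m := by exact_mod_cast h0
              nlinarith
          have h2 : (s : ℝ) * (s - 1) + β * (m - s) =
              m * (m - 1) + ((k : ℝ) - 1 - β) * (s - m) := by
            rw [← hsm]; ring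
          nlinarith
      rw [← hsm] at hmain
      nlinarith
    · intro i _
      rw [← hs, div_mul_cancel₀]
      linarith

/-! ### Bounds for the clique mass -/

theorem prod_mul_nodePair {M : Type*} [CommMonoid M] {k : ℕ} (x : Fin k → M) :
    ∏ e : NodePair k, x e.1.1 * x e.1.2 = ∏ i, x i ^ (k - 1) := by
  have := prod_nodePair_mul_swap (fun i (_ : Fin k) => x i)
  simpa using this

theorem ae_nonneg_of_measure_Iio_eq_zero (ν : Measure ℝ) (hν : ν (Set.Iio 0) = 0) :
    ∀ᵐ x ∂ν, 0 ≤ x := by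
  filter_upwards [measure_eq_zero_iff_ae_notMem.1 hν] with x hx
  simpa using hx

theorem ae_pi_nonneg {ι : Type*} [Fintype ι] (ν : Measure ℝ) [IsProbabilityMeasure ν]
    (hν : ν (Set.Iio 0) = 0) : ∀ᵐ h ∂(Measure.pi fun _ : ι => ν), ∀ i, 0 ≤ h i := by
  have h0 := ae_nonneg_of_measure_Iio_eq_zero ν hν
  exact ae_all_iff.2 fun i =>
    (measurePreserving_eval (fun _ : ι => ν) i).quasiMeasurePreserving.ae h0

/-- When all weights exceed `a`, every edge has probability 1. -/
theorem pow_tail_le_cliqueMass (ν : Measure ℝ) [IsProbabilityMeasure ν] (k : ℕ) {a : ℝ}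
    (ha : 0 < a) : ν (Set.Ioi a) ^ k ≤ cliqueMass ν k (a ^ 2) := by
  have h1 : ν (Set.Ioi a) ^ k =
      ∫⁻ h : Fin k → ℝ, ∏ i, (Set.Ioi a).indicator 1 (h i) ∂(Measure.pi fun _ => ν) := by
    rw [lintegral_pi_prod ν _ fun _ => measurable_one.indicator measurableSet_Ioi]
    simp [lintegral_indicator_one measurableSet_Ioi]
  rw [h1, cliqueMass]
  refine lintegral_mono fun h => ?_
  by_cases hall : ∀ i, h i ∈ Set.Ioi a
  · rw [Finset.prod_congr rfl fun i _ => Set.indicator_of_mem (hall i) _]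
    have : ∀ e : NodePair k, ENNReal.ofReal (min (h e.1.1 * h e.1.2 / a ^ 2) 1) = 1 := by
      intro e
      have h1 : a < h e.1.1 := hall _
      have h2 : a < h e.1.2 := hall _
      rw [min_eq_right, ENNReal.ofReal_one]
      rw [one_le_div (by positivity)]
      nlinarith
    simp [this]
  · push Not at hall
    obtain ⟨i, hi⟩ := hall
    rw [Finset.prod_eq_zero (Finset.mem_univ i) (Set.indicator_of_notMem hi _)]
    exact zero_le

theorem cliqueMass_le_moment (ν : Measure ℝ) [IsProbabilityMeasure ν]
    (hν : ν (Set.Iio 0) = 0) (k : ℕ) {a : ℝ} (ha : 0 < a) :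
    cliqueMass ν k (a ^ 2) ≤ (∫⁻ x, ENNReal.ofReal ((x / a) ^ (k - 1)) ∂ν) ^ k := by
  have h1 := lintegral_pi_prod (ι := Fin k) ν
    (fun _ x => ENNReal.ofReal ((x / a) ^ (k - 1))) (fun _ => by fun_prop)
  simp only [Finset.prod_const, Finset.card_univ, Fintype.card_fin] at h1
  rw [← h1, cliqueMass]
  refine lintegral_mono_ae ?_
  filter_upwards [ae_pi_nonneg ν hν] with h hh
  have h0 : ∀ i, 0 ≤ h i / a := fun i => div_nonneg (hh i) ha.le
  rw [← ENNReal.ofReal_prod_of_nonneg fun i _ => pow_nonneg (h0 i) _,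
    ← prod_mul_nodePair (fun i => h i / a),
    ENNReal.ofReal_prod_of_nonneg fun e _ => mul_nonneg (h0 _) (h0 _)]
  refine Finset.prod_le_prod' fun e _ => ENNReal.ofReal_le_ofReal ((min_le_left _ _).trans_eq ?_)
  rw [div_mul_div_comm, sq]

/-- When all weights lie in [0, a] no minimum is active, and each node occurs in k - 1 pairs. -/
theorem truncated_moment_le_cliqueMass (ν : Measure ℝ) [IsProbabilityMeasure ν]
    (k : ℕ) {a : ℝ} (ha : 0 < a) :
    (∫⁻ x in Set.Icc 0 a, ENNReal.ofReal ((x / a) ^ (k - 1)) ∂ν) ^ k ≤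
      cliqueMass ν k (a ^ 2) := by
  have h1 := lintegral_pi_prod (ι := Fin k) ν
    (fun _ => (Set.Icc 0 a).indicator fun x => ENNReal.ofReal ((x / a) ^ (k - 1)))
    (fun _ => Measurable.indicator (by fun_prop) measurableSet_Icc)
  simp only [Finset.prod_const, Finset.card_univ, Fintype.card_fin,
    lintegral_indicator measurableSet_Icc] at h1
  rw [← h1, cliqueMass]
  refine lintegral_mono fun h => ?_
  by_cases hall : ∀ i, h i ∈ Set.Icc 0 a
  · have h0 : ∀ i, 0 ≤ h i / a := fun i => div_nonneg (hall i).1 ha.le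
    have h1 : ∀ i, h i / a ≤ 1 := fun i => (div_le_one ha).2 (hall i).2
    simp only [Set.indicator_of_mem (hall _)]
    rw [← ENNReal.ofReal_prod_of_nonneg fun i _ => pow_nonneg (h0 i) _,
      ← prod_mul_nodePair (fun i => h i / a),
      ENNReal.ofReal_prod_of_nonneg fun e _ => mul_nonneg (h0 _) (h0 _)]
    refine Finset.prod_le_prod' fun e _ => ENNReal.ofReal_le_ofReal (le_min (le_of_eq ?_) ?_)
    · rw [div_mul_div_comm, sq]
    · exact mul_le_one₀ (h1 _) (h0 _) (h1 _)
  · push Not at hall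
    obtain ⟨i, hi⟩ := hall
    rw [Finset.prod_eq_zero (Finset.mem_univ i) (Set.indicator_of_notMem hi _)]
    exact zero_le

theorem cliqueMass_le_of_prod_min_le (ν : Measure ℝ) [IsProbabilityMeasure ν]
    (hν : ν (Set.Iio 0) = 0) {k : ℕ} {p q : ℝ}
    (hpq : ∀ x : Fin k → ℝ, (∀ i, 0 ≤ x i) → ∏ e : NodePair k, min (x e.1.1 * x e.1.2) 1 ≤
        ∏ i, if x i ≤ 1 then x i ^ p else x i ^ q) {a : ℝ} (ha : 0 < a) :
    cliqueMass ν k (a ^ 2) ≤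
      (ENNReal.ofReal (a ^ p)⁻¹ * ∫⁻ x in Set.Icc 0 a, ENNReal.ofReal (x ^ p) ∂ν +
        ENNReal.ofReal (a ^ q)⁻¹ * ∫⁻ x in Set.Ioi a, ENNReal.ofReal (x ^ q) ∂ν) ^ k := by
  set G : ℝ → ENNReal := fun x =>
    (Set.Icc 0 a).indicator (fun x => ENNReal.ofReal (a ^ p)⁻¹ * ENNReal.ofReal (x ^ p)) x +
      (Set.Ioi a).indicator (fun x => ENNReal.ofReal (a ^ q)⁻¹ * ENNReal.ofReal (x ^ q)) x
    with hG
  have hm1 : Measurable ((Set.Icc 0 a).indicator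
      (fun x => ENNReal.ofReal (a ^ p)⁻¹ * ENNReal.ofReal (x ^ p))) :=
    Measurable.indicator (by fun_prop) measurableSet_Icc
  have hm2 : Measurable ((Set.Ioi a).indicator
      (fun x => ENNReal.ofReal (a ^ q)⁻¹ * ENNReal.ofReal (x ^ q))) :=
    Measurable.indicator (by fun_prop) measurableSet_Ioi
  have h1 := lintegral_pi_prod (ι := Fin k) ν (fun _ => G) (fun _ => hm1.add hm2)
  have hGint : ∫⁻ x, G x ∂ν =
      ENNReal.ofReal (a ^ p)⁻¹ * ∫⁻ x in Set.Icc 0 a, ENNReal.ofReal (x ^ p) ∂ν +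
        ENNReal.ofReal (a ^ q)⁻¹ * ∫⁻ x in Set.Ioi a, ENNReal.ofReal (x ^ q) ∂ν := by
    rw [hG, lintegral_add_left hm1, lintegral_indicator measurableSet_Icc,
      lintegral_indicator measurableSet_Ioi, lintegral_const_mul _ (by fun_prop),
      lintegral_const_mul _ (by fun_prop)]
  simp only [Finset.prod_const, Finset.card_univ, Fintype.card_fin] at h1
  rw [← hGint, ← h1, cliqueMass]
  refine lintegral_mono_ae ?_
  filter_upwards [ae_pi_nonneg ν hν] with h hh
  have h0 : ∀ i, 0 ≤ h i / a := fun i => div_nonneg (hh i) ha.le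
  have hG' : ∀ i, G (h i) =
      ENNReal.ofReal (if h i / a ≤ 1 then (h i / a) ^ p else (h i / a) ^ q) := by
    intro i
    simp only [hG, div_le_one ha]
    split_ifs with hi
    · rw [Set.indicator_of_mem (show h i ∈ Set.Icc 0 a from ⟨hh i, hi⟩),
        Set.indicator_of_notMem (by simpa using hi), add_zero, Real.div_rpow (hh i) ha.le,
        ← ENNReal.ofReal_mul (by positivity), inv_mul_eq_div]
    · rw [Set.indicator_of_notMem (fun hmem : h i ∈ Set.Icc 0 a => hi hmem.2),
        Set.indicator_of_mem (by simpa using hi), zero_add, Real.div_rpow (hh i) ha.le,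
        ← ENNReal.ofReal_mul (by positivity), inv_mul_eq_div]
  simp only [hG']
  rw [← ENNReal.ofReal_prod_of_nonneg, ← ENNReal.ofReal_prod_of_nonneg]
  · refine ENNReal.ofReal_le_ofReal (le_trans (le_of_eq ?_) (hpq _ h0))
    refine Finset.prod_congr rfl fun e _ => ?_
    rw [div_mul_div_comm, sq]
  · intro i _
    split_ifs <;> exact Real.rpow_nonneg (h0 i) _
  · intro e _
    exact le_min (div_nonneg (mul_nonneg (hh _) (hh _)) (by positivity)) zero_le_one

theorem exists_cliqueMass_le_tail (ν : Measure ℝ) [IsProbabilityMeasure ν]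
    (hν : ν (Set.Iio 0) = 0) {k : ℕ} {β : ℝ} (hβ : 1 < β) (hk : β < (k : ℝ) - 1)
    (hT0 : ∀ x, 0 < ν.real (Set.Ioi x))
    (hT : Tendsto (fun x => ν.real (Set.Ioi (2 * x)) / ν.real (Set.Ioi x)) atTop
      (𝓝 (2 ^ (-β)))) :
    ∃ C x₀ : ℝ, 0 < C ∧ ∀ a, x₀ ≤ a →
      (cliqueMass ν k (a ^ 2)).toReal ≤ (C * ν.real (Set.Ioi a)) ^ k := by
  obtain ⟨p, q, hp, hq0, hq, hpq⟩ := exists_prod_min_le k hβ hk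
  obtain ⟨C₁, x₁, hC₁, hx₁, h₁⟩ := exists_setLIntegral_Icc_le ν hT0 hT (by linarith) hp
  obtain ⟨C₂, x₂, hC₂, hx₂, h₂⟩ := exists_setLIntegral_Ioi_le ν hT0 hT hq0 hq
  refine ⟨C₁ + C₂, max x₁ x₂, by positivity, fun a ha => ?_⟩
  have ha₁ : x₁ ≤ a := (le_max_left _ _).trans ha
  have ha₂ : x₂ ≤ a := (le_max_right _ _).trans ha
  have ha0 : 0 < a := by linarith
  have hTa := (hT0 a).le
  refine ENNReal.toReal_le_of_le_ofReal (by positivity) ?_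
  refine (cliqueMass_le_of_prod_min_le ν hν hpq ha0).trans ?_
  rw [ENNReal.ofReal_pow (by positivity)]
  gcongr
  refine (add_le_add (mul_le_mul_right (h₁ a ha₁) _)
    (mul_le_mul_right (h₂ a ha₂) _)).trans (le_of_eq ?_)
  rw [← ENNReal.ofReal_mul (by positivity), ← ENNReal.ofReal_mul (by positivity),
    ← ENNReal.ofReal_add (by positivity) (by positivity)]
  have : 0 < a ^ p := by positivity
  have : 0 < a ^ q := by positivity
  congr 1
  field_simp

theorem exists_cliqueMass_bounds_of_moment (ν : Measure ℝ) [IsProbabilityMeasure ν]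
    (hν : ν (Set.Iio 0) = 0) {k : ℕ} (hk : 1 ≤ k) {β : ℝ} (hβ : 0 < β) (hkβ : (k : ℝ) - 1 < β)
    (hT0 : ∀ x, 0 < ν.real (Set.Ioi x))
    (hT : Tendsto (fun x => ν.real (Set.Ioi (2 * x)) / ν.real (Set.Ioi x)) atTop
      (𝓝 (2 ^ (-β)))) :
    ∃ m M x₀ : ℝ, 0 < m ∧ 0 < M ∧ ∀ a, x₀ ≤ a →
      (m * (a ^ (k - 1))⁻¹) ^ k ≤ (cliqueMass ν k (a ^ 2)).toReal ∧
      (cliqueMass ν k (a ^ 2)).toReal ≤ (M * (a ^ (k - 1))⁻¹) ^ k := by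
  have hfin : ∫⁻ x, ENNReal.ofReal (x ^ (k - 1)) ∂ν < ⊤ := by
    have := lintegral_rpow_lt_top ν (q := ((k - 1 : ℕ) : ℝ)) hν hT0 hT (Nat.cast_nonneg _)
      (by push_cast [hk]; exact hkβ)
    simpa only [Real.rpow_natCast] using this
  -- The tail ratio tends to 2^(-β) < 1, so some interval (x₀, 2x₀] with x₀ ≥ 1 carries positive
  -- mass `m`; there x^(k-1) ≥ 1, which bounds the truncated moment below uniformly in a ≥ 2x₀.
  obtain ⟨x₀, hx₀, hlt⟩ : ∃ x₀ : ℝ, 1 ≤ x₀ ∧ ν.real (Set.Ioi (2 * x₀)) < ν.real (Set.Ioi x₀) := by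
    have h1 : (2 : ℝ) ^ (-β) < 1 :=
      Real.rpow_lt_one_of_one_lt_of_neg one_lt_two (by linarith)
    obtain ⟨x, hx, hx'⟩ := ((eventually_ge_atTop 1).and (hT.eventually_lt_const h1)).exists
    exact ⟨x, hx, (div_lt_one (hT0 x)).1 hx'⟩
  set m := ν.real (Set.Ioi x₀) - ν.real (Set.Ioi (2 * x₀)) with hm
  have hmIoc : ν.real (Set.Ioc x₀ (2 * x₀)) = m := by
    rw [hm, ← measureReal_sdiff (Set.Ioi_subset_Ioi (by linarith)) measurableSet_Ioi]
    congr 1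
    ext x
    simp
  set M := (∫⁻ x, ENNReal.ofReal (x ^ (k - 1)) ∂ν).toReal + 1 with hM
  have hscale : ∀ a : ℝ, 0 < a → ∀ x : ℝ, ENNReal.ofReal ((x / a) ^ (k - 1)) =
      ENNReal.ofReal (a ^ (k - 1))⁻¹ * ENNReal.ofReal (x ^ (k - 1)) := by
    intro a ha x
    rw [← ENNReal.ofReal_mul (by positivity), div_pow, inv_mul_eq_div]
  refine ⟨m, M, 2 * x₀, sub_pos.2 hlt, by positivity, fun a ha => ?_⟩
  have ha0 : 0 < a := by linarith
  have hm0 : 0 < m := sub_pos.2 hlt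
  constructor
  · rw [← ENNReal.ofReal_le_iff_le_toReal
      ((cliqueMass_le_one ν k _).trans_lt ENNReal.one_lt_top).ne]
    refine le_trans ?_ (truncated_moment_le_cliqueMass ν k ha0)
    rw [ENNReal.ofReal_pow (by positivity)]
    simp only [hscale a ha0]
    rw [lintegral_const_mul _ (by fun_prop), mul_comm m, ENNReal.ofReal_mul (by positivity)]
    gcongr
    calc ENNReal.ofReal m = ∫⁻ _ in Set.Ioc x₀ (2 * x₀), 1 ∂ν := by
          rw [setLIntegral_const, one_mul, ← hmIoc, ofReal_measureReal]
      _ ≤ ∫⁻ x in Set.Ioc x₀ (2 * x₀), ENNReal.ofReal (x ^ (k - 1)) ∂ν := by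
          refine setLIntegral_mono' measurableSet_Ioc fun x hx => ?_
          rw [← ENNReal.ofReal_one]
          exact ENNReal.ofReal_le_ofReal (one_le_pow₀ (hx₀.trans hx.1.le))
      _ ≤ _ := lintegral_mono_set
          fun x (hx : x ∈ Set.Ioc x₀ (2 * x₀)) => Set.mem_Icc.2 ⟨by linarith [hx.1], hx.2.trans ha⟩
  · refine ENNReal.toReal_le_of_le_ofReal (by positivity) ?_
    refine (cliqueMass_le_moment ν hν k ha0).trans ?_
    rw [ENNReal.ofReal_pow (by positivity)]
    simp only [hscale a ha0]
    rw [lintegral_const_mul _ (by fun_prop), mul_comm M, ENNReal.ofReal_mul (by positivity)]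
    gcongr
    rw [← ENNReal.ofReal_toReal hfin.ne]
    exact ENNReal.ofReal_le_ofReal (by linarith)

theorem mean_pos (ν : Measure ℝ) [IsProbabilityMeasure ν] (hν : ν (Set.Iio 0) = 0) {β : ℝ}
    (hβ : 1 < β) (hT0 : ∀ x, 0 < ν.real (Set.Ioi x))
    (hT : Tendsto (fun x => ν.real (Set.Ioi (2 * x)) / ν.real (Set.Ioi x)) atTop
      (𝓝 (2 ^ (-β)))) : 0 < ∫ x, x ∂ν := by
  have h0 : 0 ≤ᵐ[ν] fun x => x := ae_nonneg_of_measure_Iio_eq_zero ν hν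
  -- Integrability is essential: otherwise the Bochner integral would be 0 by convention.
  have hint : Integrable (fun x : ℝ => x) ν := by
    refine ⟨by fun_prop, ?_⟩
    rw [hasFiniteIntegral_iff_ofReal h0]
    simpa using lintegral_rpow_lt_top ν hν hT0 hT zero_le_one hβ
  rw [integral_pos_iff_support_of_nonneg_ae h0 hint]
  have h1 : 0 < ν (Set.Ioi (0 : ℝ)) := by
    have := hT0 0
    rw [Measure.real, ENNReal.toReal_pos_iff] at this
    exact this.1
  exact h1.trans_le (measure_mono fun x hx => (ne_of_gt hx : x ≠ 0))

/-! ### Binomial factor and regular variation of the tail -/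

theorem sameOrder_choose_mul {k : ℕ} {Q w : ℕ → ℝ} {c C : ℝ} (hc : 0 < c) (hC : 0 < C)
    (hw : ∀ᶠ n in atTop, 0 ≤ w n) (hlow : ∀ᶠ n in atTop, (c * w n) ^ k ≤ Q n)
    (hup : ∀ᶠ n in atTop, Q n ≤ (C * w n) ^ k) :
    SameOrder (fun n => (n.choose k : ℝ) * Q n) (fun n => (n : ℝ) ^ k * w n ^ k) := by
  obtain ⟨n₀, hn₀⟩ := eventually_atTop.1
    (hw.and (hlow.and (hup.and (eventually_ge_atTop (2 * k)))))
  set c' := c ^ k / (2 ^ k * k.factorial) with hc'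
  have hc'0 : 0 < c' := by positivity
  -- Adding c' to the upper constant only secures the strict inequality C₁ < C₂.
  refine ⟨n₀, c', C ^ k + c', hc'0, by linarith [pow_pos hC k], fun n hn => ?_⟩
  obtain ⟨hwn, hl, hu, hnk⟩ := hn₀ n hn.le
  have hwk : 0 ≤ w n ^ k := pow_nonneg hwn k
  have hQ : 0 ≤ Q n := (pow_nonneg (mul_nonneg hc.le hwn) k).trans hl
  have hnn : (0 : ℝ) ≤ (n : ℝ) ^ k := by positivity
  constructor
  · have h1 : ((n : ℝ) / 2) ^ k ≤ k.factorial * n.choose k := by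
      rw [← div_le_iff₀' (by positivity)]
      refine le_trans ?_ (Nat.pow_le_choose (α := ℝ) k n)
      gcongr
      have : n ≤ 2 * (n + 1 - k) := by omega
      have : (n : ℝ) ≤ 2 * ((n + 1 - k : ℕ) : ℝ) := by exact_mod_cast this
      linarith
    have h2 : (n : ℝ) ^ k / (2 ^ k * k.factorial) ≤ n.choose k := by
      rw [div_le_iff₀ (by positivity)]
      rw [div_pow, div_le_iff₀ (by positivity)] at h1
      linarith
    calc c' * ((n : ℝ) ^ k * w n ^ k) = (n : ℝ) ^ k / (2 ^ k * k.factorial) * (c * w n) ^ k := by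
          rw [hc', mul_pow]; ring
      _ ≤ n.choose k * Q n := by gcongr
  · have h1 : (n.choose k : ℝ) ≤ (n : ℝ) ^ k := by exact_mod_cast Nat.choose_le_pow n k
    calc n.choose k * Q n ≤ (n : ℝ) ^ k * (C * w n) ^ k := by gcongr
      _ = C ^ k * ((n : ℝ) ^ k * w n ^ k) := by rw [mul_pow]; ring
      _ ≤ (C ^ k + c') * ((n : ℝ) ^ k * w n ^ k) := by
          gcongr
          linarith

/-- Slow variation at c = 1 forces l ≠ 0 eventually, because 0 / 0 = 0 in Lean; so the tail is
nonzero at arbitrarily large points, hence positive everywhere by monotonicity. -/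
theorem tail_pos {α : ℝ} {l : ℝ → ℝ} (hl : IsSlowlyVarying l)
    (ν : Measure ℝ) [IsProbabilityMeasure ν]
    (hν_tail : ∀ h : ℝ, 1 ≤ h → ν.real (Set.Ioi h) = h ^ (1 - α) * l h) (x : ℝ) :
    0 < ν.real (Set.Ioi x) := by
  have h := (hl 1 one_pos).eventually_const_lt (zero_lt_one' ℝ)
  obtain ⟨y, hy, hxy, hy1⟩ :=
    (h.and ((eventually_ge_atTop x).and (eventually_ge_atTop 1))).exists
  have hly : l y ≠ 0 := by
    intro h0
    simp [h0] at hy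
  have hy0 : 0 < y := by linarith
  have hpos : ν.real (Set.Ioi y) ≠ 0 := by
    rw [hν_tail y hy1]
    exact mul_ne_zero (Real.rpow_pos_of_pos hy0 _).ne' hly
  exact (measureReal_nonneg.lt_of_ne' hpos).trans_le (measureReal_mono (Set.Ioi_subset_Ioi hxy))

theorem tendsto_tail_ratio {α : ℝ} {l : ℝ → ℝ} (hl : IsSlowlyVarying l)
    (ν : Measure ℝ)
    (hν_tail : ∀ h : ℝ, 1 ≤ h → ν.real (Set.Ioi h) = h ^ (1 - α) * l h) {c : ℝ} (hc : 0 < c) :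
    Tendsto (fun x => ν.real (Set.Ioi (c * x)) / ν.real (Set.Ioi x)) atTop
      (𝓝 (c ^ (-(α - 1)))) := by
  have h := (hl c hc).const_mul (c ^ (-(α - 1)))
  rw [mul_one] at h
  refine h.congr' ?_
  filter_upwards [eventually_ge_atTop 1,
    (tendsto_id.const_mul_atTop hc).eventually_ge_atTop 1] with x hx hcx
  have hx0 : 0 < x := by linarith
  rw [hν_tail x hx, hν_tail (c * x) hcx, Real.mul_rpow hc.le hx0.le, neg_sub]
  have := (Real.rpow_pos_of_pos hx0 (1 - α)).ne'
  field_simp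

end ChungLu

/-! ### The two regimes -/

theorem corollary2 (α : ℝ) (hα : 2 < α) (hαint : ∀ m : ℤ, α ≠ (m : ℝ))
    (l : ℝ → ℝ) (hl : IsSlowlyVarying l)
    (ν : Measure ℝ) [IsProbabilityMeasure ν] (hν_nonneg : ν (Set.Iio 0) = 0)
    (hν_tail : ∀ h : ℝ, 1 ≤ h → ν.real (Set.Ioi h) = h ^ (1 - α) * l h)
    (k : ℕ) (hk : 2 ≤ k) :
    (∀ n : ℕ, k ≤ n →
      ChungLu.expectedCliques ν k n = (n.choose k : ℝ) * ChungLu.cliqueProb ν k n) ∧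
    ((k : ℝ) < α →
      SameOrder (fun n => ChungLu.expectedCliques ν k n)
        (fun n => (n : ℝ) ^ ((k : ℝ) / 2 * (3 - (k : ℝ))))) ∧
    (α < (k : ℝ) →
      SameOrder (fun n => ChungLu.expectedCliques ν k n)
        (fun n => (n : ℝ) ^ ((k : ℝ) / 2 * (3 - α)) * l (Real.sqrt (n : ℝ)) ^ k)) := by
  have hT0 := ChungLu.tail_pos hl ν hν_tail
  have hT := ChungLu.tendsto_tail_ratio hl ν hν_tail two_pos
  have hμ : 0 < ∫ h, h ∂ν := ChungLu.mean_pos ν hν_nonneg (by linarith) hT0 hT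
  set μ := ∫ h, h ∂ν with hμdef
  have hμs : 0 < √μ := Real.sqrt_pos.2 hμ
  have hsq : ∀ n : ℕ, μ * n = (√μ * √(n : ℝ)) ^ 2 := by
    intro n
    rw [mul_pow, Real.sq_sqrt hμ.le, Real.sq_sqrt (Nat.cast_nonneg n)]
  have hexp : ∀ n : ℕ, ChungLu.expectedCliques ν k n =
      (n.choose k : ℝ) * (ChungLu.cliqueMass ν k ((√μ * √(n : ℝ)) ^ 2)).toReal := by
    intro n
    rw [ChungLu.expectedCliques_eq, ← hμdef, hsq]
  have hsqrt : Tendsto (fun n : ℕ => √(n : ℝ)) atTop atTop :=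
    Real.tendsto_sqrt_atTop.comp tendsto_natCast_atTop_atTop
  have hscaled : Tendsto (fun n : ℕ => √μ * √(n : ℝ)) atTop atTop := hsqrt.const_mul_atTop hμs
  refine ⟨fun n hn => ?_, fun hkα => ?_, fun hkα => ?_⟩
  · rw [ChungLu.expectedCliques_eq, ChungLu.cliqueProb_eq ν hn]
  · obtain ⟨m, M, x₀, hm, hM, hbd⟩ := ChungLu.exists_cliqueMass_bounds_of_moment ν hν_nonneg
      (k := k) (by omega) (β := α - 1) (by linarith) (by linarith) hT0 hT
    have hpow : ∀ (m : ℝ) (n : ℕ), m * ((√μ * √(n : ℝ)) ^ (k - 1))⁻¹ =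
        m * (√μ ^ (k - 1))⁻¹ * (√(n : ℝ) ^ (k - 1))⁻¹ := by
      intro m n
      rw [mul_pow, mul_inv, mul_assoc]
    have hmain := ChungLu.sameOrder_choose_mul (k := k)
      (Q := fun n => (ChungLu.cliqueMass ν k ((√μ * √(n : ℝ)) ^ 2)).toReal)
      (w := fun n => (√(n : ℝ) ^ (k - 1))⁻¹)
      (c := m * (√μ ^ (k - 1))⁻¹) (C := M * (√μ ^ (k - 1))⁻¹) (by positivity) (by positivity)
      (Eventually.of_forall fun n => by positivity)
      (by
        filter_upwards [hscaled.eventually_ge_atTop x₀] with n hn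
        rw [← hpow]
        exact (hbd _ hn).1)
      (by
        filter_upwards [hscaled.eventually_ge_atTop x₀] with n hn
        rw [← hpow]
        exact (hbd _ hn).2)
    obtain ⟨n₀, C₁, C₂, h1, h2, h3⟩ := hmain
    refine ⟨n₀, C₁, C₂, h1, h2, fun n hn => ?_⟩
    have hn0 : (0 : ℝ) < n := by exact_mod_cast (Nat.zero_le _).trans_lt hn
    have hg : (n : ℝ) ^ ((k : ℝ) / 2 * (3 - (k : ℝ))) =
        (n : ℝ) ^ k * ((√(n : ℝ) ^ (k - 1))⁻¹) ^ k := by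
      rw [inv_pow, ← pow_mul, Real.sqrt_eq_rpow, ← Real.rpow_natCast (n : ℝ) k,
        ← Real.rpow_natCast _ ((k - 1) * k), ← Real.rpow_mul hn0.le, ← Real.rpow_neg hn0.le,
        ← Real.rpow_add hn0]
      congr 1
      push_cast [show 1 ≤ k by omega]
      ring
    simp only [hexp, hg]
    exact h3 n hn
  · obtain ⟨C, x₀, hC, hup⟩ := ChungLu.exists_cliqueMass_le_tail ν hν_nonneg (k := k)
      (β := α - 1) (by linarith) (by linarith) hT0 hT
    -- The clique mass lives at scale √μ √n, the claim at √n; the tails at the two scales have ratio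
    -- tending to ρ > 0.
    have hratio := (ChungLu.tendsto_tail_ratio hl ν hν_tail hμs).comp hsqrt
    set ρ := √μ ^ (-(α - 1)) with hρ
    have hρ0 : 0 < ρ := Real.rpow_pos_of_pos hμs _
    have hlo := hratio.eventually_const_le (show ρ / 2 < ρ by linarith)
    have hhi := hratio.eventually_le_const (show ρ < 2 * ρ by linarith)
    have hmain := ChungLu.sameOrder_choose_mul (k := k)
      (Q := fun n => (ChungLu.cliqueMass ν k ((√μ * √(n : ℝ)) ^ 2)).toReal)
      (w := fun n => ν.real (Set.Ioi √(n : ℝ)))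
      (c := ρ / 2) (C := C * (2 * ρ)) (by positivity) (by positivity)
      (Eventually.of_forall fun n => measureReal_nonneg)
      (by
        filter_upwards [hlo, hscaled.eventually_gt_atTop 0] with n hn hn0
        rw [Function.comp_apply, le_div_iff₀ (hT0 _)] at hn
        have h1 := ENNReal.toReal_mono
          ((ChungLu.cliqueMass_le_one ν k _).trans_lt ENNReal.one_lt_top).ne
          (ChungLu.pow_tail_le_cliqueMass ν k hn0)
        rw [ENNReal.toReal_pow] at h1
        refine le_trans (pow_le_pow_left₀ (mul_nonneg (by positivity) (hT0 _).le) hn k) h1)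
      (by
        filter_upwards [hhi, hscaled.eventually_ge_atTop x₀] with n hn hn0
        rw [Function.comp_apply, div_le_iff₀ (hT0 _)] at hn
        refine (hup _ hn0).trans (pow_le_pow_left₀ (mul_nonneg hC.le (hT0 _).le) ?_ k)
        rw [mul_assoc]
        exact mul_le_mul_of_nonneg_left hn hC.le)
    obtain ⟨n₀, C₁, C₂, h1, h2, h3⟩ := hmain
    refine ⟨n₀, C₁, C₂, h1, h2, fun n hn => ?_⟩
    have hn1 : (1 : ℝ) ≤ n := by exact_mod_cast (Nat.zero_le _).trans_lt hn
    have hn0 : (0 : ℝ) < n := by linarith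
    have hg : (n : ℝ) ^ ((k : ℝ) / 2 * (3 - α)) * l √(n : ℝ) ^ k =
        (n : ℝ) ^ k * ν.real (Set.Ioi √(n : ℝ)) ^ k := by
      rw [hν_tail _ (Real.one_le_sqrt.2 hn1), mul_pow, ← mul_assoc]
      congr 1
      rw [Real.sqrt_eq_rpow, ← Real.rpow_natCast (n : ℝ) k, ← Real.rpow_mul hn0.le,
        ← Real.rpow_natCast (_ ^ _) k, ← Real.rpow_mul hn0.le, ← Real.rpow_add hn0]
      congr 1
      ring
    simp only [hexp, hg]
    exact h3 n hn
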